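/- Cubes in $\mathbb R^n$ ($n\ge 1$) are half-open with sides parallel to the axes; $\ell_Q$ is the sidelength of $Q$, and $2^mQ$ is the cube concentric with $Q$ of sidelength $2^m\ell_Q$. Let $\mathcal D$ be the standard dyadic grid, i.e. all cubes $2^{-k}([0,1)^n+j)$, $k\in\mathbb Z$, $j\in\mathbb Z^n$. A dyadic grid is a collection $\mathscr D$ of cubes such that (i) every sidelength is of the form $2^k$, $k\in\mathbb Z$; (ii) $Q\cap R\in\{Q,R,\emptyset\}$ for all $Q,R\in\mathscr D$; (iii) for each $k\in\mathbb Z$ the cubes of sidelength $2^k$ partition $\mathbb R^n$. A family $\mathcal S=\{Q_j^k\}$, $k=0,1,2,\dots$, is sparse if, with $\Omega_k=\bigcup_jQ_j^k$: the cubes $Q^k_j$ are disjoint in $j$ for each fixed $k$, $\Omega_{k+1}\subset\Omega_k$, and $|\Omega_{k+1}\cap Q_j^k|\le\frac12|Q_j^k|$. For a measurable $f:\mathbb R^n\to\mathbb R$ write $f_Q=\frac1{|Q|}\int_Q|f|\in[0,\infty]$ and $$\mathcal T^{\mathcal S}_{2,m}f(x)=\Big(\sum_{j,k}(f_{2^mQ_j^k})^2\chi_{Q_j^k}(x)\Big)^{1/2}.$$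 Let $\mu$ be a $\sigma$-finite Borel measure on $\mathbb R^n$ absolutely continuous with respect to Lebesgue measure (for instance Lebesgue measure itself, or $w\,dx$ with a weight $w$). A Banach function space $X$ over $(\mathbb R^n,\mu)$ is given by a function norm: a map $\rho$ from the measurable functions $h:\mathbb R^n\to[0,\infty]$ to $[0,\infty]$ such that $\rho(h)=0$ iff $h=0$ $\mu$-a.e.; $\rho(ah)=a\rho(h)$ for $a\ge0$; $\rho(g+h)\le\rho(g)+\rho(h)$; $g\le h$ $\mu$-a.e. implies $\rho(g)\le\rho(h)$; $h_k\uparrow h$ $\mu$-a.e. implies $\rho(h_k)\uparrow\rho(h)$; and, whenever $\mu(E)<\infty$, $\rho(\chi_E)<\infty$ and $\int_Eh\,d\mu\le C_E\,\rho(h)$ for all $h$, with $C_E<\infty$ independent of $h$. Put $\|h\|_X=\rho(|h|)$ and $\|h\|_{X^{(2)}}=\||h|^2\|_X^{1/2}$. **Lemma 4.3.** There are $2^n$ dyadic grids $\mathscr D_1,\dots,\mathscr D_{2^n}$ with the following covering property: for every cube $Q\subset\mathbb R^n$ there are an $i$ and a cube $Q_i\in\mathscr D_i$ with $Q\subset Q_i$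 and $\ell_{Q_i}\le 6\ell_Q$. Moreover there is a constant $c_n<\infty$ depending only on $n$ such that, for any $2^n$ dyadic grids $\mathscr D_i$ with the covering property, any $\mu$ as above, any Banach function space $X$ over $(\mathbb R^n,\mu)$, any measurable $f$ and any integer $m\ge1$, $$\sup_{\mathcal S\subset\mathcal D}\|\mathcal T^{\mathcal S}_{2,m}f\|_{X^{(2)}}\le c_n\,m^{1/2}\max_{1\le i\le 2^n}\ \sup_{\mathcal S\subset\mathscr D_i}\|\mathcal T^{\mathcal S}_{2,0}f\|_{X^{(2)}},$$ where the suprema are over the sparse families $\mathcal S$ of cubes of the indicated grid, and both sides may be $\infty$. -/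

import Mathlib

open MeasureTheory
open scoped NNReal ENNReal

namespace SparseSquare

/-- A half-open cube in `ℝⁿ` with sides parallel to the axes, given by its corner with smallest
coordinates and its (positive) sidelength. -/
structure Cube (n : ℕ) where
  corner : Fin n → ℝ
  side : ℝ
  side_pos : 0 < side

/-- The set of points of the cube, `∏ᵢ [cornerᵢ, cornerᵢ + side)`. -/
def Cube.toSet {n : ℕ} (Q : Cube n) : Set (Fin n → ℝ) :=
  {x | ∀ i, Q.corner i ≤ x i ∧ x i < Q.corner i + Q.side}

/-- `2^m Q`: the cube with the same centre as `Q` and `2^m` times its sidelength. -/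
noncomputable def Cube.dilate {n : ℕ} (m : ℕ) (Q : Cube n) : Cube n where
  corner := fun i => Q.corner i + Q.side / 2 - 2 ^ m * Q.side / 2
  side := 2 ^ m * Q.side
  side_pos := mul_pos (by positivity) Q.side_pos

/-- The standard dyadic grid: the cubes `2^{-k}([0,1)ⁿ + j)` with `k ∈ ℤ`, `j ∈ ℤⁿ`. -/
def standardGrid (n : ℕ) : Set (Cube n) :=
  {Q | ∃ (k : ℤ) (j : Fin n → ℤ),
    Q.side = (2 : ℝ) ^ (-k) ∧ ∀ i, Q.corner i = (2 : ℝ) ^ (-k) * (j i : ℝ)}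

/-- A general dyadic grid: all sidelengths are powers `2^k`, `k ∈ ℤ`; any two cubes are nested
or disjoint; the cubes of each fixed sidelength `2^k` partition `ℝⁿ`. -/
structure IsDyadicGrid {n : ℕ} (D : Set (Cube n)) : Prop where
  side_eq : ∀ Q ∈ D, ∃ k : ℤ, Q.side = (2 : ℝ) ^ k
  nested : ∀ Q ∈ D, ∀ R ∈ D, Q.toSet ∩ R.toSet = Q.toSet ∨ Q.toSet ∩ R.toSet = R.toSet ∨
    Q.toSet ∩ R.toSet = ∅
  partition : ∀ (k : ℤ) (x : Fin n → ℝ), ∃! Q : Cube n,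
    Q ∈ D ∧ Q.side = (2 : ℝ) ^ k ∧ x ∈ Q.toSet

/-- A system of `2ⁿ` dyadic grids `D i` such that every cube `Q ⊆ ℝⁿ` is contained in some cube,
belonging to one of the grids, of sidelength at most `6` times that of `Q`. -/
structure IsCoveringSystem {n : ℕ} (D : Fin (2 ^ n) → Set (Cube n)) : Prop where
  grid : ∀ i, IsDyadicGrid (D i)
  covers : ∀ Q : Cube n, ∃ i, ∃ P ∈ D i, Q.toSet ⊆ P.toSet ∧ P.side ≤ 6 * Q.side

/-- The set `Ω_k`, the union of the cubes `Q_j^k` of the `k`-th generation. -/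
def levelSet {n : ℕ} (S : ℕ → Set (Cube n)) (k : ℕ) : Set (Fin n → ℝ) :=
  ⋃ Q ∈ S k, Q.toSet

/-- A sparse family `{Q_j^k}`; `S k` is the set of the cubes `Q_j^k` with this `k`. -/
structure IsSparse {n : ℕ} (S : ℕ → Set (Cube n)) : Prop where
  disjoint : ∀ k, (S k).PairwiseDisjoint Cube.toSet
  antitone : ∀ k, levelSet S (k + 1) ⊆ levelSet S k
  half : ∀ k, ∀ Q ∈ S k, volume (levelSet S (k + 1) ∩ Q.toSet) ≤ volume Q.toSet / 2

/-- The mean value of `|f|` over the cube `Q`, in `[0, ∞]`. -/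
noncomputable def avg {n : ℕ} (f : (Fin n → ℝ) → ℝ) (Q : Cube n) : ℝ≥0∞ :=
  (∫⁻ x in Q.toSet, ‖f x‖ₑ) / volume Q.toSet

/-- `T^S_{2,m} f (x) = (∑_{j,k} (f_{2^m Q_j^k})² χ_{Q_j^k}(x))^{1/2}`. -/
noncomputable def sparseSquare {n : ℕ} (m : ℕ) (S : ℕ → Set (Cube n)) (f : (Fin n → ℝ) → ℝ)
    (x : Fin n → ℝ) : ℝ≥0∞ :=
  (∑' k : ℕ, ∑' Q : S k,
    (Q : Cube n).toSet.indicator (fun _ => avg f ((Q : Cube n).dilate m) ^ 2) x) ^ (1 / 2 : ℝ)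

/-- A Banach function norm on the measure space `(ℝⁿ, μ)`: a map `ρ` from the nonnegative
measurable functions to `[0, ∞]` with the usual axioms. The corresponding Banach function space
`X` consists of the measurable functions `h` with `‖h‖_X = ρ(|h|) < ∞`. The values of `norm` at
nonmeasurable functions are irrelevant. -/
structure BanachFunctionNorm {n : ℕ} (μ : Measure (Fin n → ℝ)) where
  norm : ((Fin n → ℝ) → ℝ≥0∞) → ℝ≥0∞
  eq_zero_iff : ∀ f, Measurable f → (norm f = 0 ↔ f =ᵐ[μ] 0)
  smul : ∀ (a : ℝ≥0) (f), Measurable f → norm (fun x => a * f x) = a * norm f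
  triangle : ∀ f g, Measurable f → Measurable g → norm (fun x => f x + g x) ≤ norm f + norm g
  mono : ∀ f g, Measurable f → Measurable g → f ≤ᵐ[μ] g → norm f ≤ norm g
  fatou : ∀ (F : ℕ → (Fin n → ℝ) → ℝ≥0∞) (f : (Fin n → ℝ) → ℝ≥0∞),
    (∀ k, Measurable (F k)) → Measurable f → (∀ᵐ x ∂μ, Monotone fun k => F k x) →
    (∀ᵐ x ∂μ, ⨆ k, F k x = f x) → norm f = ⨆ k, norm (F k)
  norm_indicator_lt_top : ∀ E : Set (Fin n → ℝ), MeasurableSet E → μ E < ∞ →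
    norm (E.indicator fun _ => 1) < ∞
  lintegral_le : ∀ E : Set (Fin n → ℝ), MeasurableSet E → μ E < ∞ →
    ∃ C : ℝ≥0, ∀ f, Measurable f → ∫⁻ x in E, f x ∂μ ≤ C * norm f

/-- The norm `‖h‖_{X^{(2)}} = ‖h²‖_X^{1/2}` of a nonnegative function `h`. -/
noncomputable def BanachFunctionNorm.normTwo {n : ℕ} {μ : Measure (Fin n → ℝ)}
    (X : BanachFunctionNorm μ) (h : (Fin n → ℝ) → ℝ≥0∞) : ℝ≥0∞ :=
  X.norm (fun x => h x ^ 2) ^ (1 / 2 : ℝ)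

/-- The supremum of `‖T^S_{2,m} f‖_{X^{(2)}}` over all sparse families `S` of cubes of `D`. -/
noncomputable def supSparse {n : ℕ} {μ : Measure (Fin n → ℝ)} (X : BanachFunctionNorm μ)
    (m : ℕ) (D : Set (Cube n)) (f : (Fin n → ℝ) → ℝ) : ℝ≥0∞ :=
  ⨆ (S : ℕ → Set (Cube n)) (_ : IsSparse S) (_ : ∀ k, S k ⊆ D), X.normTwo (sparseSquare m S f)

end SparseSquare

/-!
The inequality follows from a pointwise sparse domination, so that no duality in `X` is needed.

Let `S` be a sparse family of standard dyadic cubes. Each `2^m Q`, `Q ∈ S k`, lies in a cube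
`P(Q)` of one of the grids `D i`, whose sidelength is `2^(m+t)` times that of `Q` with
`t ∈ {0, 1, 2}`; hence the mean of `|f|` over `2^m Q` is at most `6^n` times its mean over `P(Q)`.
The cubes `Q` are sorted into classes by the index `i`, the number `t`, and the level of `P(Q)`
modulo `m + t`. There are `O(m)` classes, which is the source of the factor `m^(1/2)`; it remains
to bound the sum over one class by a square function `T_{2,0}` of a sparse family in `D i`,
with a constant independent of `m`.

Within a class, any cube `P(Q')` strictly inside `P(Q)` is at most as large as `Q`. Once `Q` is
replaced by the cubes of `D i` of the same size that meet it, the number of cubes `P(Q)` with `Q`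
covering a point is therefore constant on each smaller `P(Q')`, up to the term of `P(Q')` itself.
So one can stop at a cube as soon as the mean of `|f|` has become four times the initial one, or
this number exceeds a constant depending on `n`. The first kind of stopping cubes is small by the
weak type estimate of the maximal operator, the second by the Carleson packing condition of `S`
(`IsSparse.sum_volume_le`). Iterating gives `exists_sparse_domination`, for finitely many cubes;
`norm_sum_avg_dilate_le` collects the classes, and the Fatou property of the norm passes to the
whole of `S`.

The covering system is that of the one-third trick: for each subset of the coordinates, the dyadic
grid translated by a third in these coordinates (`exists_shift_interval`).
-/

namespace SparseSquare

variable {n : ℕ}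

/-! ### Cubes -/


theorem Cube.toSet_eq_pi (Q : Cube n) :
    Q.toSet = Set.univ.pi fun i => Set.Ico (Q.corner i) (Q.corner i + Q.side) := by
  ext x; simp [Cube.toSet]

theorem Cube.measurableSet (Q : Cube n) : MeasurableSet Q.toSet := by
  rw [Q.toSet_eq_pi]
  exact MeasurableSet.univ_pi fun i => measurableSet_Ico

theorem Cube.volume_toSet (Q : Cube n) : volume Q.toSet = ENNReal.ofReal Q.side ^ n := by
  rw [Q.toSet_eq_pi, Real.volume_pi_Ico]
  simp

theorem Cube.volume_pos (Q : Cube n) : 0 < volume Q.toSet := by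
  rw [Q.volume_toSet]
  exact ENNReal.pow_pos (by simpa using Q.side_pos) n

theorem Cube.volume_ne_top (Q : Cube n) : volume Q.toSet ≠ ∞ := by
  rw [Q.volume_toSet]
  exact ENNReal.pow_ne_top ENNReal.ofReal_ne_top

theorem Cube.corner_mem (Q : Cube n) : Q.corner ∈ Q.toSet := fun i =>
  ⟨le_rfl, by linarith [Q.side_pos]⟩

theorem Cube.subset_iff {P R : Cube n} : P.toSet ⊆ R.toSet ↔
    ∀ i, R.corner i ≤ P.corner i ∧ P.corner i + P.side ≤ R.corner i + R.side := by
  constructor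
  · intro h i
    refine ⟨(h P.corner_mem i).1, ?_⟩
    by_contra! hlt
    -- the point of `P` whose `i`-th coordinate is moved up to the right end of `R`
    have hx : Function.update P.corner i (max (P.corner i) (R.corner i + R.side)) ∈ P.toSet := by
      intro j
      rcases eq_or_ne j i with rfl | hj
      · simp only [Function.update_self]
        exact ⟨le_max_left _ _, max_lt (by linarith [P.side_pos]) hlt⟩
      · simp only [Function.update_of_ne hj]
        exact P.corner_mem j
    have := (h hx i).2
    simp only [Function.update_self] at this
    linarith [le_max_right (P.corner i) (R.corner i + R.side)]
  · intro h x hx i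
    have h1 := h i
    have h2 := hx i
    constructor <;> linarith

theorem Cube.side_le_of_subset (hn : 1 ≤ n) {P R : Cube n} (h : P.toSet ⊆ R.toSet) :
    P.side ≤ R.side := by
  have := Cube.subset_iff.1 h ⟨0, hn⟩
  linarith

theorem Cube.eq_of_subset_of_side_le {P R : Cube n} (h : P.toSet ⊆ R.toSet)
    (hs : R.side ≤ P.side) (hn : 1 ≤ n) : P = R := by
  have hside : P.side = R.side := le_antisymm (Cube.side_le_of_subset hn h) hs
  rw [Cube.subset_iff] at h
  obtain ⟨c, s, hs0⟩ := P
  obtain ⟨c', s', hs0'⟩ := R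
  simp only at hside h
  subst hside
  congr
  funext i
  exact le_antisymm (by linarith [(h i).2]) (h i).1

theorem Cube.dilate_zero (Q : Cube n) : Q.dilate 0 = Q := by
  obtain ⟨c, s, hs⟩ := Q
  simp [Cube.dilate]

theorem Cube.subset_dilate (m : ℕ) (Q : Cube n) : Q.toSet ⊆ (Q.dilate m).toSet := by
  rw [Cube.subset_iff]
  intro i
  have h1 : (1 : ℝ) ≤ 2 ^ m := one_le_pow₀ (by norm_num)
  have h2 : Q.side ≤ 2 ^ m * Q.side := le_mul_of_one_le_left Q.side_pos.le h1
  simp only [Cube.dilate]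
  constructor <;> linarith

theorem avg_mul_volume (f : (Fin n → ℝ) → ℝ) (Q : Cube n) :
    avg f Q * volume Q.toSet = ∫⁻ x in Q.toSet, ‖f x‖ₑ :=
  ENNReal.div_mul_cancel Q.volume_pos.ne' Q.volume_ne_top

/-- Passing to a larger cube costs at most the ratio of the volumes. -/
theorem avg_le_mul_avg (f : (Fin n → ℝ) → ℝ) {R P : Cube n} (h : R.toSet ⊆ P.toSet) {c : ℝ}
    (hc : 0 ≤ c) (hside : P.side ≤ c * R.side) :
    avg f R ≤ ENNReal.ofReal c ^ n * avg f P := by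
  have hv : volume P.toSet ≤ ENNReal.ofReal c ^ n * volume R.toSet := by
    rw [P.volume_toSet, R.volume_toSet, ← mul_pow, ← ENNReal.ofReal_mul hc]
    gcongr
  rw [avg, ENNReal.div_le_iff R.volume_pos.ne' R.volume_ne_top]
  calc ∫⁻ x in R.toSet, ‖f x‖ₑ ≤ ∫⁻ x in P.toSet, ‖f x‖ₑ := lintegral_mono_set h
    _ = avg f P * volume P.toSet := (avg_mul_volume f P).symm
    _ ≤ avg f P * (ENNReal.ofReal c ^ n * volume R.toSet) := by gcongr
    _ = _ := by ring

/-! ### Dyadic grids -/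

theorem IsDyadicGrid.eq_of_side_eq {D : Set (Cube n)} (hD : IsDyadicGrid D) {P R : Cube n}
    (hP : P ∈ D) (hR : R ∈ D) (hs : P.side = R.side) {x : Fin n → ℝ} (hxP : x ∈ P.toSet)
    (hxR : x ∈ R.toSet) : P = R := by
  obtain ⟨k, hk⟩ := hD.side_eq P hP
  exact (hD.partition k x).unique ⟨hP, hk, hxP⟩ ⟨hR, hs ▸ hk, hxR⟩

/-- Of two cubes of a dyadic grid with a common point, the smaller is contained in the larger. -/
theorem IsDyadicGrid.subset_of_side_le (hn : 1 ≤ n) {D : Set (Cube n)} (hD : IsDyadicGrid D)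
    {P R : Cube n} (hP : P ∈ D) (hR : R ∈ D) (hs : P.side ≤ R.side) {x : Fin n → ℝ}
    (hxP : x ∈ P.toSet) (hxR : x ∈ R.toSet) : P.toSet ⊆ R.toSet := by
  rcases hD.nested P hP R hR with h | h | h
  · exact Set.inter_eq_left.1 h
  · rw [Cube.eq_of_subset_of_side_le (Set.inter_eq_right.1 h) hs hn]
  · exact absurd (h ▸ ⟨hxP, hxR⟩ : x ∈ (∅ : Set (Fin n → ℝ))) (Set.notMem_empty x)

theorem IsDyadicGrid.countable_side {D : Set (Cube n)} (hD : IsDyadicGrid D) (s : ℝ) :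
    {Q ∈ D | Q.side = s}.Countable := by
  have h := Measure.countable_meas_pos_of_disjoint_iUnion (μ := (volume : Measure (Fin n → ℝ)))
    (As := fun Q : {Q ∈ D | Q.side = s} => (Q : Cube n).toSet)
    (fun Q => (Q : Cube n).measurableSet) (by
      intro Q R hQR
      refine Set.disjoint_left.2 fun x hxQ hxR => hQR (Subtype.ext ?_)
      exact hD.eq_of_side_eq Q.2.1 R.2.1 (Q.2.2.trans R.2.2.symm) hxQ hxR)
  have huniv : {Q : {Q ∈ D | Q.side = s} | 0 < volume (Q : Cube n).toSet} = Set.univ :=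
    Set.eq_univ_of_forall fun Q => (Q : Cube n).volume_pos
  rw [huniv] at h
  exact Set.countable_coe_iff.1 (Set.countable_univ_iff.1 h)

theorem IsDyadicGrid.countable {D : Set (Cube n)} (hD : IsDyadicGrid D) : D.Countable := by
  refine (Set.countable_iUnion fun k : ℤ => hD.countable_side ((2 : ℝ) ^ k)).mono ?_
  intro Q hQ
  obtain ⟨k, hk⟩ := hD.side_eq Q hQ
  exact Set.mem_iUnion.2 ⟨k, hQ, hk⟩

/-- The dyadic grid whose cubes of sidelength `2^k` have their corners in the lattice `2^k ℤⁿ`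
translated by `(-2)^k b / 3`. The sign alternates because `(-2)^(k+1) / 3` and `(-2)^k / 3` differ
by an integer multiple of `2^k`, which makes the successive translated lattices nested. -/
def shiftedGrid (b : Fin n → ℤ) : Set (Cube n) :=
  {Q | ∃ (k : ℤ) (j : Fin n → ℤ), Q.side = (2 : ℝ) ^ k ∧
    ∀ i, Q.corner i = (-2 : ℝ) ^ k * (b i / 3) + (2 : ℝ) ^ k * j i}

theorem standardGrid_eq_shiftedGrid : standardGrid n = shiftedGrid 0 := by
  ext Q
  constructor
  · rintro ⟨k, j, h1, h2⟩
    exact ⟨-k, j, h1, fun i => by simp [h2 i]⟩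
  · rintro ⟨k, j, h1, h2⟩
    exact ⟨-k, j, by simpa using h1, fun i => by simp [h2 i]⟩

theorem neg_two_zpow_eq_or (k : ℤ) :
    (-2 : ℝ) ^ k = 2 ^ k ∨ (-2 : ℝ) ^ k = -2 ^ k := by
  rcases Int.even_or_odd k with h | h
  · exact Or.inl (h.neg_zpow _)
  · exact Or.inr (h.neg_zpow _)

theorem exists_neg_two_zpow_add (k : ℤ) (d : ℕ) :
    ∃ t : ℤ, (-2 : ℝ) ^ (k + d) / 3 = (-2 : ℝ) ^ k / 3 + 2 ^ k * t := by
  induction d with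
  | zero => exact ⟨0, by simp⟩
  | succ d ih =>
    obtain ⟨t, ht⟩ := ih
    have h1 : (-2 : ℝ) ^ (k + (d + 1 : ℕ)) / 3 = (-2 : ℝ) ^ (k + d) / 3 - (-2 : ℝ) ^ (k + d) := by
      rw [show k + ((d + 1 : ℕ) : ℤ) = (k + d) + 1 by push_cast; ring,
        zpow_add_one₀ (by norm_num)]
      ring
    have h2 : (-2 : ℝ) ^ (k + d) = (-2 : ℝ) ^ k * (-2) ^ d := by
      rw [zpow_add₀ (by norm_num), zpow_natCast]
    rcases neg_two_zpow_eq_or k with h | h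
    · refine ⟨t - (-2) ^ d, ?_⟩
      rw [h1, ht, h2, h]; push_cast; ring
    · refine ⟨t + (-2) ^ d, ?_⟩
      rw [h1, ht, h2, h]; push_cast; ring

theorem shiftedGrid_subset (b : Fin n → ℤ) {Q R : Cube n} (hQ : Q ∈ shiftedGrid b)
    (hR : R ∈ shiftedGrid b) (hs : Q.side ≤ R.side) {x : Fin n → ℝ} (hxQ : x ∈ Q.toSet)
    (hxR : x ∈ R.toSet) : Q.toSet ⊆ R.toSet := by
  obtain ⟨k, j, hk, hj⟩ := hQ
  obtain ⟨l, j', hl, hj'⟩ := hR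
  rw [hk, hl, zpow_le_zpow_iff_right₀ (by norm_num)] at hs
  obtain ⟨d, rfl⟩ := Int.le.dest hs
  obtain ⟨t, ht⟩ := exists_neg_two_zpow_add k d
  rw [Cube.subset_iff]
  intro i
  have h2 : (0 : ℝ) < 2 ^ k := by positivity
  have hpow : (2 : ℝ) ^ (k + d) = 2 ^ k * ((2 ^ d : ℤ) : ℝ) := by
    rw [zpow_add₀ (by norm_num), zpow_natCast]; push_cast; rfl
  have hQi := hxQ i
  have hRi := hxR i
  -- in the coordinates of the finer lattice both cubes have integer corners
  have hcR : R.corner i =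
      (-2 : ℝ) ^ k * (b i / 3) + 2 ^ k * ((b i * t + 2 ^ d * j' i : ℤ) : ℝ) := by
    rw [hj' i, hpow]
    have : (-2 : ℝ) ^ (k + (d : ℤ)) * (b i / 3) = b i * ((-2 : ℝ) ^ (k + (d : ℤ)) / 3) := by ring
    rw [this, ht]; push_cast; ring
  rw [hj i, hk] at hQi
  rw [hcR, hl, hpow] at hRi
  rw [hj i, hk, hcR, hl, hpow]
  have e1 : (2 : ℝ) ^ k * ((b i * t + 2 ^ d * j' i : ℤ) : ℝ) < 2 ^ k * ((j i + 1 : ℤ) : ℝ) := by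
    push_cast at hRi ⊢; linarith
  have e2 : (2 : ℝ) ^ k * (j i : ℝ) < 2 ^ k * ((b i * t + 2 ^ d * j' i + 2 ^ d : ℤ) : ℝ) := by
    push_cast at hRi ⊢; linarith
  have f1 := Int.lt_add_one_iff.1 (Int.cast_lt.1 (lt_of_mul_lt_mul_left e1 h2.le))
  have f2 := Int.add_one_le_iff.2 (Int.cast_lt.1 (lt_of_mul_lt_mul_left e2 h2.le))
  have g1 : (2 : ℝ) ^ k * ((b i * t + 2 ^ d * j' i : ℤ) : ℝ) ≤ 2 ^ k * (j i : ℝ) :=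
    mul_le_mul_of_nonneg_left (Int.cast_le.2 f1) h2.le
  have g2 : (2 : ℝ) ^ k * ((j i + 1 : ℤ) : ℝ) ≤
      2 ^ k * ((b i * t + 2 ^ d * j' i + 2 ^ d : ℤ) : ℝ) :=
    mul_le_mul_of_nonneg_left (Int.cast_le.2 f2) h2.le
  push_cast at g1 g2 ⊢
  constructor <;> linarith

theorem isDyadicGrid_shiftedGrid (hn : 1 ≤ n) (b : Fin n → ℤ) : IsDyadicGrid (shiftedGrid b) where
  side_eq := fun Q ⟨k, _, hk, _⟩ => ⟨k, hk⟩
  nested := by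
    intro Q hQ R hR
    rcases Set.eq_empty_or_nonempty (Q.toSet ∩ R.toSet) with h | ⟨x, hxQ, hxR⟩
    · exact Or.inr (Or.inr h)
    · rcases le_total Q.side R.side with hs | hs
      · exact Or.inl (Set.inter_eq_left.2 (shiftedGrid_subset b hQ hR hs hxQ hxR))
      · exact Or.inr (Or.inl (Set.inter_eq_right.2 (shiftedGrid_subset b hR hQ hs hxR hxQ)))
  partition := by
    intro k x
    have h2 : (0 : ℝ) < 2 ^ k := by positivity
    let j : Fin n → ℤ := fun i => ⌊(x i - (-2 : ℝ) ^ k * (b i / 3)) / 2 ^ k⌋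
    refine ⟨⟨fun i => (-2 : ℝ) ^ k * (b i / 3) + 2 ^ k * j i, 2 ^ k, h2⟩,
      ⟨⟨k, j, rfl, fun i => rfl⟩, rfl, fun i => ?_⟩, ?_⟩
    · have h3 := Int.floor_le ((x i - (-2 : ℝ) ^ k * (b i / 3)) / 2 ^ k)
      have h4 := Int.lt_floor_add_one ((x i - (-2 : ℝ) ^ k * (b i / 3)) / 2 ^ k)
      rw [le_div_iff₀ h2] at h3
      rw [div_lt_iff₀ h2] at h4
      constructor <;> simp only [j] <;> linarith
    · rintro R ⟨hR, hRs, hxR⟩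
      refine Cube.eq_of_subset_of_side_le (shiftedGrid_subset b hR ⟨k, j, rfl, fun i => rfl⟩
        hRs.le hxR fun i => ?_) hRs.ge hn
      have h3 := Int.floor_le ((x i - (-2 : ℝ) ^ k * (b i / 3)) / 2 ^ k)
      have h4 := Int.lt_floor_add_one ((x i - (-2 : ℝ) ^ k * (b i / 3)) / 2 ^ k)
      rw [le_div_iff₀ h2] at h3
      rw [div_lt_iff₀ h2] at h4
      constructor <;> simp only [j] <;> linarith

/-- The one-third trick on the line: an interval of length at most a third of `2^k` lies in an
interval of length `2^k` of the untranslated or of the translated lattice. -/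
theorem exists_shift_interval (k : ℤ) (a s : ℝ) (hs : 3 * s ≤ 2 ^ k) :
    ∃ (b : Fin 2) (j : ℤ), (-2 : ℝ) ^ k * ((b : ℕ) / 3) + 2 ^ k * j ≤ a ∧
      a + s ≤ (-2 : ℝ) ^ k * ((b : ℕ) / 3) + 2 ^ k * j + 2 ^ k := by
  have h2 : (0 : ℝ) < 2 ^ k := by positivity
  by_contra! hcon
  have key : ∀ (b : Fin 2), ∃ j : ℤ, a < (-2 : ℝ) ^ k * ((b : ℕ) / 3) + 2 ^ k * j ∧
      (-2 : ℝ) ^ k * ((b : ℕ) / 3) + 2 ^ k * j < a + s := by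
    intro b
    have h3 := Int.floor_le ((a - (-2 : ℝ) ^ k * ((b : ℕ) / 3)) / 2 ^ k)
    have h4 := Int.lt_floor_add_one ((a - (-2 : ℝ) ^ k * ((b : ℕ) / 3)) / 2 ^ k)
    rw [le_div_iff₀ h2] at h3
    rw [div_lt_iff₀ h2] at h4
    have h5 := hcon b ⌊(a - (-2 : ℝ) ^ k * ((b : ℕ) / 3)) / 2 ^ k⌋ (by linarith)
    refine ⟨⌊(a - (-2 : ℝ) ^ k * ((b : ℕ) / 3)) / 2 ^ k⌋ + 1, ?_, ?_⟩ <;> push_cast <;> linarith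
  obtain ⟨j0, hj0, hj0'⟩ := key 0
  obtain ⟨j1, hj1, hj1'⟩ := key 1
  simp only [Fin.isValue, Fin.val_zero, Fin.val_one, Nat.cast_zero, Nat.cast_one]
    at hj0 hj0' hj1 hj1'
  -- points of the two lattices are at distance at least `2^k / 3`
  obtain ⟨e, he, hek⟩ : ∃ e : ℤ, (e = 1 ∨ e = -1) ∧ (-2 : ℝ) ^ k = 2 ^ k * e := by
    rcases neg_two_zpow_eq_or k with h | h
    · exact ⟨1, Or.inl rfl, by simp [h]⟩
    · exact ⟨-1, Or.inr rfl, by simp [h]⟩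
  rw [hek] at hj0 hj0' hj1 hj1'
  have u1 : (2 : ℝ) ^ k * ((e + 3 * j1 - 3 * j0 : ℤ) : ℝ) < 2 ^ k * ((1 : ℤ) : ℝ) := by
    push_cast; linarith
  have u2 : (2 : ℝ) ^ k * ((-1 : ℤ) : ℝ) < 2 ^ k * ((e + 3 * j1 - 3 * j0 : ℤ) : ℝ) := by
    push_cast; linarith
  have v1 := Int.cast_lt.1 (lt_of_mul_lt_mul_left u1 h2.le)
  have v2 := Int.cast_lt.1 (lt_of_mul_lt_mul_left u2 h2.le)
  omega

theorem exists_isCoveringSystem (hn : 1 ≤ n) :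
    ∃ D : Fin (2 ^ n) → Set (Cube n), IsCoveringSystem D := by
  refine ⟨fun i => shiftedGrid fun l => ((finFunctionFinEquiv.symm i l : ℕ) : ℤ),
    ⟨fun i => isDyadicGrid_shiftedGrid hn _, fun Q => ?_⟩⟩
  obtain ⟨k, hk1, hk2⟩ := exists_mem_Ioc_zpow (mul_pos three_pos Q.side_pos) one_lt_two
  have hpow : (2 : ℝ) ^ (k + 1) = 2 * 2 ^ k := by
    rw [zpow_add_one₀ (by norm_num), mul_comm]
  choose b j hj1 hj2 using fun i : Fin n => exists_shift_interval (k + 1) (Q.corner i) Q.side hk2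
  refine ⟨finFunctionFinEquiv b, ⟨_, 2 ^ (k + 1), by positivity⟩,
    ⟨k + 1, j, rfl, fun i => rfl⟩, ?_, ?_⟩
  · rw [Cube.subset_iff]
    intro i
    simpa using ⟨hj1 i, hj2 i⟩
  · simp only
    rw [hpow]; linarith

/-! ### Finite families and stopping cubes -/

/-- The weak type estimate of the dyadic maximal operator, for finitely many cubes of a grid. -/
theorem IsDyadicGrid.mul_volume_iUnion_le (hn : 1 ≤ n) {D : Set (Cube n)} (hD : IsDyadicGrid D)
    (g : (Fin n → ℝ) → ℝ≥0∞) (t : ℝ≥0∞) (T : Finset (Cube n)) (hT : ∀ P ∈ T, P ∈ D)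
    (E : Set (Fin n → ℝ)) (hE : ∀ P ∈ T, P.toSet ⊆ E)
    (ht : ∀ P ∈ T, t * volume P.toSet ≤ ∫⁻ x in P.toSet, g x) :
    t * volume (⋃ P ∈ T, P.toSet) ≤ ∫⁻ x in E, g x := by
  classical
  set M := T.filter fun P => ∀ R ∈ T, P.toSet ⊆ R.toSet → R = P with hM
  have hMT : ∀ P ∈ M, P ∈ T := fun P hP => (Finset.mem_filter.1 hP).1
  have hcover : (⋃ P ∈ T, P.toSet) ⊆ ⋃ P ∈ M, P.toSet := by
    refine Set.iUnion₂_subset fun P hP => ?_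
    obtain ⟨R, hR, hmax⟩ := (T.filter fun R => P.toSet ⊆ R.toSet).exists_max_image Cube.side
      ⟨P, by simp [hP]⟩
    rw [Finset.mem_filter] at hR
    refine hR.2.trans (Set.subset_biUnion_of_mem (u := Cube.toSet) (s := (M : Set (Cube n))) ?_)
    simp only [hM, Finset.coe_filter, Set.mem_ofPred_eq]
    refine ⟨hR.1, fun R' hR' hsub => ?_⟩
    exact (Cube.eq_of_subset_of_side_le hsub
      (hmax R' (Finset.mem_filter.2 ⟨hR', hR.2.trans hsub⟩)) hn).symm
  have hdisj : (M : Set (Cube n)).PairwiseDisjoint Cube.toSet := by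
    intro P hP R hR hPR
    refine Set.disjoint_left.2 fun x hxP hxR => hPR ?_
    have hP' := Finset.mem_filter.1 (Finset.mem_coe.1 hP)
    have hR' := Finset.mem_filter.1 (Finset.mem_coe.1 hR)
    rcases le_total P.side R.side with hs | hs
    · exact (hP'.2 R hR'.1
        (hD.subset_of_side_le hn (hT P hP'.1) (hT R hR'.1) hs hxP hxR)).symm
    · exact hR'.2 P hP'.1
        (hD.subset_of_side_le hn (hT R hR'.1) (hT P hP'.1) hs hxR hxP)
  calc t * volume (⋃ P ∈ T, P.toSet) ≤ t * volume (⋃ P ∈ M, P.toSet) := by gcongr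
    _ = ∑ P ∈ M, t * volume P.toSet := by
        rw [measure_biUnion_finset hdisj fun P _ => P.measurableSet, Finset.mul_sum]
    _ ≤ ∑ P ∈ M, ∫⁻ x in P.toSet, g x := Finset.sum_le_sum fun P hP => ht P (hMT P hP)
    _ = ∫⁻ x in ⋃ P ∈ M, P.toSet, g x :=
        (lintegral_biUnion_finset hdisj (fun P _ => P.measurableSet) g).symm
    _ ≤ ∫⁻ x in E, g x := lintegral_mono_set (Set.iUnion₂_subset fun P hP => hE P (hMT P hP))

theorem volume_iUnion_avg_gt_le (hn : 1 ≤ n) {D : Set (Cube n)} (hD : IsDyadicGrid D)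
    (f : (Fin n → ℝ) → ℝ) (P₀ : Cube n) (T : Finset (Cube n)) (hT : ∀ P ∈ T, P ∈ D)
    (hsub : ∀ P ∈ T, P.toSet ⊆ P₀.toSet) (havg : ∀ P ∈ T, 4 * avg f P₀ < avg f P) :
    volume (⋃ P ∈ T, P.toSet) ≤ volume P₀.toSet / 4 := by
  rcases T.eq_empty_or_nonempty with rfl | ⟨R, hR⟩
  · simp
  have htop : avg f P₀ ≠ ∞ := by
    intro h
    have := havg R hR
    simp [h] at this
  have h0 : avg f P₀ ≠ 0 := by
    intro h
    have h1 : ∫⁻ x in P₀.toSet, ‖f x‖ₑ = 0 := by rw [← avg_mul_volume, h, zero_mul]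
    have h2 : avg f R = 0 := by
      rw [avg, ENNReal.div_eq_zero_iff]
      exact Or.inl (le_antisymm (h1 ▸ lintegral_mono_set (hsub R hR)) zero_le)
    have := havg R hR
    simp [h2] at this
  have h := hD.mul_volume_iUnion_le hn (fun x => ‖f x‖ₑ) (4 * avg f P₀) T hT P₀.toSet hsub
    fun P hP => by
      rw [← avg_mul_volume]
      gcongr
      exact (havg P hP).le
  rw [← avg_mul_volume, mul_comm 4, mul_assoc, ENNReal.mul_le_mul_iff_right h0 htop] at h
  rw [ENNReal.le_div_iff_mul_le (by simp) (by simp), mul_comm]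
  exact h

/-- By Markov's inequality, more than `4 K` of the sets `N P` can overlap on at most a quarter
of `P₀`. -/
theorem volume_overlap_gt_le (P₀ : Cube n) (U : Finset (Cube n))
    (N : Cube n → Set (Fin n → ℝ)) (hN : ∀ P ∈ U, MeasurableSet (N P)) {K : ℝ≥0∞} (hK0 : K ≠ 0)
    (hK : K ≠ ∞) (hU : ∑ P ∈ U, volume (N P) ≤ K * volume P₀.toSet)
    (E : Set (Fin n → ℝ)) (hE : ∀ x ∈ E, 4 * K < ∑ P ∈ U, (N P).indicator 1 x) :
    volume E ≤ volume P₀.toSet / 4 := by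
  have hmeas : Measurable fun x => ∑ P ∈ U, (N P).indicator (1 : (Fin n → ℝ) → ℝ≥0∞) x :=
    Finset.measurable_fun_sum U fun P hP => measurable_one.indicator (hN P hP)
  have h := mul_meas_ge_le_lintegral (μ := volume) hmeas (4 * K)
  rw [lintegral_finsetSum' U fun P hP => (measurable_one.indicator (hN P hP)).aemeasurable] at h
  have h2 : ∑ P ∈ U, ∫⁻ x, (N P).indicator (1 : (Fin n → ℝ) → ℝ≥0∞) x =
      ∑ P ∈ U, volume (N P) :=
    Finset.sum_congr rfl fun P hP => lintegral_indicator_one (hN P hP)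
  rw [h2] at h
  have h3 := (mul_le_mul_right (measure_mono fun x hx => (hE x hx).le :
    volume E ≤ volume {x | 4 * K ≤ ∑ P ∈ U, (N P).indicator 1 x}) (4 * K)).trans (h.trans hU)
  rw [mul_comm 4, mul_assoc, ENNReal.mul_le_mul_iff_right hK0 hK] at h3
  rw [ENNReal.le_div_iff_mul_le (by simp) (by simp), mul_comm]
  exact h3

open scoped Classical in
/-- The strict subcubes of each cube of `F` that belong to `F` cover at most half of it. -/
def HasSparseChildren (F : Finset (Cube n)) : Prop :=
  ∀ P ∈ F, volume (⋃ R ∈ {R ∈ F | R.toSet ⊆ P.toSet ∧ R ≠ P}, R.toSet) ≤ volume P.toSet / 2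

open scoped Classical in
/-- Pointwise sparse domination for a finite family `T` of cubes of a grid, with multiplicities
given by sets `N P ⊆ P` that satisfy a Carleson packing condition and are constant on the
strict subcubes of `P` in `T`.

The induction removes a cube `P₀` of maximal sidelength together with all its subcubes that are
not below a stopping cube. A cube stops if the mean of `f` exceeds four times the mean over `P₀`,
or if more than `4 K` of the sets `N P`, `P` strictly above, cover it; by the weak type estimate
and the packing condition the stopping cubes fill at most half of `P₀`. -/
theorem exists_sparse_domination (hn : 1 ≤ n) {D : Set (Cube n)} (hD : IsDyadicGrid D)
    (f : (Fin n → ℝ) → ℝ) (N : Cube n → Set (Fin n → ℝ)) {K : ℝ≥0∞} (hK0 : K ≠ 0) (hK : K ≠ ∞)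
    (T : Finset (Cube n)) (hT : ∀ P ∈ T, P ∈ D) (hNm : ∀ P ∈ T, MeasurableSet (N P))
    (hNsub : ∀ P ∈ T, N P ⊆ P.toSet)
    (hpack : ∀ P₀ ∈ T, ∑ P ∈ T with P.toSet ⊆ P₀.toSet, volume (N P) ≤ K * volume P₀.toSet)
    (hconst : ∀ P ∈ T, ∀ R ∈ T, P.toSet ⊆ R.toSet → P ≠ R →
      ∀ x ∈ P.toSet, ∀ y ∈ P.toSet, x ∈ N R → y ∈ N R) :
    ∃ F ⊆ T, HasSparseChildren F ∧
      ∀ x, ∑ P ∈ T, (N P).indicator (fun _ => avg f P ^ 2) x ≤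
        16 * (4 * K + 1) * ∑ P ∈ F, P.toSet.indicator (fun _ => avg f P ^ 2) x := by
  induction T using Finset.strongInduction with
  | H T ih =>
  rcases T.eq_empty_or_nonempty with rfl | hne
  · exact ⟨∅, le_rfl, by simp [HasSparseChildren], by simp⟩
  obtain ⟨P₀, hP₀, hmax⟩ := T.exists_max_image Cube.side hne
  set U : Cube n → Finset (Cube n) := fun P =>
    {R ∈ T | R.toSet ⊆ P₀.toSet ∧ P.toSet ⊆ R.toSet ∧ R ≠ P} with hU
  set halts : Cube n → Prop := fun P => 4 * avg f P₀ < avg f P ∨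
    ∀ x ∈ P.toSet, 4 * K < ∑ R ∈ U P, (N R).indicator 1 x with hhalt
  set below : Cube n → Prop := fun P => ∃ R ∈ T, R.toSet ⊆ P₀.toSet ∧ halts R ∧ P.toSet ⊆ R.toSet
    with hbelow
  have hUP₀ : U P₀ = ∅ := by
    refine Finset.filter_eq_empty_iff.2 fun R hR h => h.2.2 ?_
    exact (Cube.eq_of_subset_of_side_le h.2.1 (hmax R hR) hn).symm
  have hP₀halt : ¬ halts P₀ := by
    rintro (h | h)
    · refine absurd h (not_lt.2 ?_)
      exact le_mul_of_one_le_left' (by norm_num)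
    · have := h _ P₀.corner_mem
      simp [hUP₀] at this
  have hP₀below : ¬ below P₀ := by
    rintro ⟨R, hR, hRP, hsR, hPR⟩
    exact hP₀halt (Cube.eq_of_subset_of_side_le hPR (hmax R hR) hn ▸ hsR)
  set T' := {P ∈ T | P.toSet ⊆ P₀.toSet → below P} with hT'
  have hT'T : T' ⊆ T := Finset.filter_subset _ _
  have hss : T' ⊂ T := Finset.filter_ssubset.2 ⟨P₀, hP₀, fun h => hP₀below (h subset_rfl)⟩
  obtain ⟨F, hFT', hF, hFsum⟩ := ih T' hss (fun P hP => hT P (hT'T hP))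
    (fun P hP => hNm P (hT'T hP)) (fun P hP => hNsub P (hT'T hP))
    (fun P hP => (Finset.sum_le_sum_of_subset
      (Finset.filter_subset_filter _ hT'T)).trans (hpack P (hT'T hP)))
    (fun P hP R hR => hconst P (hT'T hP) R (hT'T hR))
  have hP₀F : P₀ ∉ F := fun h => hP₀below ((Finset.mem_filter.1 (hFT' h)).2 subset_rfl)
  refine ⟨insert P₀ F, Finset.insert_subset hP₀ (hFT'.trans hT'T), ?_, fun x => ?_⟩
  · intro P hP
    rcases Finset.mem_insert.1 hP with rfl | hPF
    · -- both kinds of stopping cubes fill at most a quarter of the top cube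
      set A := {R ∈ T | R.toSet ⊆ P.toSet ∧ 4 * avg f P < avg f R} with hA
      set E : Set (Fin n → ℝ) := {x | 4 * K < ∑ R ∈ T with R.toSet ⊆ P.toSet, (N R).indicator 1 x}
        with hE
      have hcov : (⋃ R ∈ {R ∈ insert P F | R.toSet ⊆ P.toSet ∧ R ≠ P}, R.toSet) ⊆
          (⋃ R ∈ A, R.toSet) ∪ E := by
        refine Set.iUnion₂_subset fun R hR => ?_
        obtain ⟨hR1, hR2, hR3⟩ := Finset.mem_filter.1 hR
        have hRF := Finset.mem_of_mem_insert_of_ne hR1 hR3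
        obtain ⟨V, hV, hVP, hVs, hRV⟩ := (Finset.mem_filter.1 (hFT' hRF)).2 hR2
        rcases hVs with h | h
        · exact hRV.trans (Set.subset_union_of_subset_left (Set.subset_biUnion_of_mem
            (u := Cube.toSet) (s := (A : Set (Cube n))) (by simp [hA, hV, hVP, h])) _)
        · refine fun x hx => Or.inr ((h x (hRV hx)).trans_le ?_)
          refine Finset.sum_le_sum_of_subset fun W hW => ?_
          simp only [hU, Finset.mem_filter] at hW ⊢
          exact ⟨hW.1, hW.2.1⟩
      have h1 : volume (⋃ R ∈ A, R.toSet) ≤ volume P.toSet / 4 :=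
        volume_iUnion_avg_gt_le hn hD f P A (fun R hR => hT R (Finset.mem_filter.1 hR).1)
          (fun R hR => (Finset.mem_filter.1 hR).2.1) fun R hR => (Finset.mem_filter.1 hR).2.2
      have h2 : volume E ≤ volume P.toSet / 4 :=
        volume_overlap_gt_le P {R ∈ T | R.toSet ⊆ P.toSet} N
          (fun R hR => hNm R (Finset.mem_filter.1 hR).1) hK0 hK (hpack P hP₀) E fun x hx => hx
      calc _ ≤ volume ((⋃ R ∈ A, R.toSet) ∪ E) := measure_mono hcov
        _ ≤ volume P.toSet / 4 + volume P.toSet / 4 :=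
          (measure_union_le _ _).trans (add_le_add h1 h2)
        _ = volume P.toSet / 2 := by
          rw [← two_mul, ENNReal.div_eq_inv_mul, ENNReal.div_eq_inv_mul, ← mul_assoc]
          congr 1
          rw [show (4 : ℝ≥0∞) = 2 * 2 by norm_num, ENNReal.mul_inv (by simp) (by simp),
            ← mul_assoc, ENNReal.mul_inv_cancel (by simp) (by simp), one_mul]
    · refine le_trans (measure_mono ?_) (hF P hPF)
      refine Set.iUnion₂_subset fun R hR => ?_
      obtain ⟨hR1, hR2, hR3⟩ := Finset.mem_filter.1 hR
      rcases Finset.mem_insert.1 hR1 with rfl | hRF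
      · exact absurd (Cube.eq_of_subset_of_side_le hR2 (hmax P (hT'T (hFT' hPF))) hn) hR3
      · exact Set.subset_biUnion_of_mem (u := Cube.toSet)
          (s := (({R ∈ F | R.toSet ⊆ P.toSet ∧ R ≠ P} : Finset (Cube n)) : Set (Cube n)))
          (by simp [hRF, hR2, hR3])
  · have hrest : ∑ P ∈ T with ¬ (P.toSet ⊆ P₀.toSet → below P),
        (N P).indicator (fun _ => avg f P ^ 2) x ≤
        16 * (4 * K + 1) * P₀.toSet.indicator (fun _ => avg f P₀ ^ 2) x := by
      set V := {P ∈ T | ¬ (P.toSet ⊆ P₀.toSet → below P)} with hV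
      have hVmem : ∀ P ∈ V, P ∈ T ∧ P.toSet ⊆ P₀.toSet ∧ ¬ below P := fun P hP => by
        simpa [hV] using hP
      by_cases hx : x ∈ P₀.toSet
      swap
      · refine (Finset.sum_eq_zero fun P hP => ?_).trans_le zero_le
        obtain ⟨h1, h2, -⟩ := hVmem P hP
        exact Set.indicator_of_notMem (fun h => hx (h2 (hNsub P h1 h))) _
      rw [Set.indicator_of_mem hx]
      have hnhalt : ∀ P ∈ V, ¬ halts P := fun P hP hs =>
        (hVmem P hP).2.2 ⟨P, (hVmem P hP).1, (hVmem P hP).2.1, hs, subset_rfl⟩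
      have hterm : ∀ P ∈ V, (N P).indicator (fun _ => avg f P ^ 2) x ≤
          16 * avg f P₀ ^ 2 * (N P).indicator 1 x := by
        intro P hP
        by_cases hxN : x ∈ N P
        · simp only [Set.indicator_of_mem hxN, Pi.one_apply, mul_one]
          have h := not_lt.1 fun h => hnhalt P hP (Or.inl h)
          calc avg f P ^ 2 ≤ (4 * avg f P₀) ^ 2 := by gcongr
            _ = _ := by rw [mul_pow]; norm_num
        · simp [hxN]
      have hcount : ∑ P ∈ V, (N P).indicator (1 : (Fin n → ℝ) → ℝ≥0∞) x ≤ 4 * K + 1 := by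
        set G := {P ∈ V | x ∈ P.toSet} with hG
        have hVG : ∑ P ∈ V, (N P).indicator (1 : (Fin n → ℝ) → ℝ≥0∞) x =
            ∑ P ∈ G, (N P).indicator (1 : (Fin n → ℝ) → ℝ≥0∞) x := by
          refine (Finset.sum_subset (Finset.filter_subset _ _) fun P hP hPG => ?_).symm
          refine Set.indicator_of_notMem (fun h => hPG ?_) _
          exact Finset.mem_filter.2 ⟨hP, hNsub P (hVmem P hP).1 h⟩
        rw [hVG]
        rcases G.eq_empty_or_nonempty with hGe | hGne
        · simp [hGe]
        -- apart from the smallest cube, those that contain `x` are counted by its stopping rule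
        obtain ⟨P, hP, hmin⟩ := G.exists_min_image Cube.side hGne
        obtain ⟨hPV, hxP⟩ := Finset.mem_filter.1 hP
        have hPT := (hVmem P hPV).1
        obtain ⟨y, hy, hyK⟩ : ∃ y ∈ P.toSet, ∑ R ∈ U P, (N R).indicator 1 y ≤ 4 * K := by
          by_contra! hcon
          exact hnhalt P hPV (Or.inr hcon)
        rw [← Finset.sum_erase_add _ _ hP]
        refine add_le_add (le_trans ?_ hyK) (Set.indicator_le_self' (by simp) x |>.trans le_rfl)
        have hsub : G.erase P ⊆ U P := by
          intro R hR
          obtain ⟨hRP, hRG⟩ := Finset.mem_erase.1 hR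
          obtain ⟨hRV, hxR⟩ := Finset.mem_filter.1 hRG
          refine Finset.mem_filter.2 ⟨(hVmem R hRV).1, (hVmem R hRV).2.1, ?_, hRP⟩
          exact hD.subset_of_side_le hn (hT P hPT) (hT R (hVmem R hRV).1) (hmin R hRG) hxP hxR
        refine (Finset.sum_le_sum_of_subset hsub).trans (Finset.sum_le_sum fun R hR => ?_)
        obtain ⟨hRT, -, hPR, hne'⟩ := Finset.mem_filter.1 hR
        by_cases hxN : x ∈ N R
        · rw [Set.indicator_of_mem hxN,
            Set.indicator_of_mem (hconst P hPT R hRT hPR hne'.symm x hxP y hy hxN)]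
          simp
        · simp [hxN]
      calc _ ≤ ∑ P ∈ V, 16 * avg f P₀ ^ 2 * (N P).indicator 1 x := Finset.sum_le_sum hterm
        _ = 16 * avg f P₀ ^ 2 * ∑ P ∈ V, (N P).indicator 1 x := Finset.mul_sum _ _ _ |>.symm
        _ ≤ 16 * avg f P₀ ^ 2 * (4 * K + 1) := by gcongr
        _ = _ := by ring
    rw [Finset.sum_insert hP₀F, mul_add,
      ← Finset.sum_filter_add_sum_filter_not T (fun P => P.toSet ⊆ P₀.toSet → below P), add_comm]
    exact add_le_add hrest (hFsum x)

/-! ### Sparse families -/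

open scoped Classical in
/-- The family `F` sorted into generations: the generation of a cube is the number of cubes of `F`
that strictly contain it. -/
noncomputable def generation (F : Finset (Cube n)) (k : ℕ) : Finset (Cube n) :=
  {P ∈ F | ({R ∈ F | P.toSet ⊆ R.toSet ∧ R ≠ P} : Finset (Cube n)).card = k}

theorem isSparse_generation (hn : 1 ≤ n) {D : Set (Cube n)} (hD : IsDyadicGrid D)
    {F : Finset (Cube n)} (hFD : ∀ P ∈ F, P ∈ D) (hF : HasSparseChildren F) :
    IsSparse fun k => (generation F k : Set (Cube n)) := by
  classical
  set above : Cube n → Finset (Cube n) := fun P => {R ∈ F | P.toSet ⊆ R.toSet ∧ R ≠ P} with habove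
  have hmem : ∀ {k P}, P ∈ generation F k ↔ P ∈ F ∧ (above P).card = k := by
    intro k P
    rw [generation, Finset.mem_filter]
  have hanti : ∀ P R, P.toSet ⊆ R.toSet → P ≠ R → R ∉ above R ∧ above R ⊆ above P := by
    intro P R hPR hne
    have hsub : above R ⊆ above P := by
      intro V hV
      obtain ⟨h1, h2, h3⟩ := Finset.mem_filter.1 hV
      refine Finset.mem_filter.2 ⟨h1, hPR.trans h2, ?_⟩
      rintro rfl
      exact h3 (Cube.eq_of_subset_of_side_le h2 (Cube.side_le_of_subset hn hPR) hn).symm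
    exact ⟨by simp [habove], hsub⟩
  have hlt : ∀ P, ∀ R ∈ F, P.toSet ⊆ R.toSet → P ≠ R → (above R).card < (above P).card := by
    intro P R hR hPR hne
    obtain ⟨h2, h3⟩ := hanti P R hPR hne
    exact Finset.card_lt_card ⟨h3, fun h => h2 (h (by simp [habove, hR, hPR, hne.symm]))⟩
  have hcomp : ∀ P ∈ F, ∀ R ∈ F, ∀ x ∈ P.toSet, x ∈ R.toSet →
      P.toSet ⊆ R.toSet ∨ R.toSet ⊆ P.toSet := by
    intro P hP R hR x hxP hxR
    rcases le_total P.side R.side with hs | hs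
    · exact Or.inl (hD.subset_of_side_le hn (hFD P hP) (hFD R hR) hs hxP hxR)
    · exact Or.inr (hD.subset_of_side_le hn (hFD R hR) (hFD P hP) hs hxR hxP)
  constructor
  · intro k P hP R hR hPR
    obtain ⟨hP1, hP2⟩ := hmem.1 (Finset.mem_coe.1 hP)
    obtain ⟨hR1, hR2⟩ := hmem.1 (Finset.mem_coe.1 hR)
    refine Set.disjoint_left.2 fun x hxP hxR => ?_
    rcases hcomp P hP1 R hR1 x hxP hxR with h | h
    · have := hlt P R hR1 h hPR; omega
    · have := hlt R P hP1 h hPR.symm; omega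
  · intro k x hx
    obtain ⟨P, hP, hxP⟩ := Set.mem_iUnion₂.1 hx
    obtain ⟨hP1, hP2⟩ := hmem.1 (Finset.mem_coe.1 hP)
    -- the smallest cube strictly above `P` is its parent in the previous generation
    obtain ⟨R, hR, hmin⟩ := (above P).exists_min_image Cube.side
      (Finset.card_pos.1 (by omega))
    obtain ⟨hR1, hR2, hR3⟩ := Finset.mem_filter.1 hR
    refine Set.mem_iUnion₂.2 ⟨R, Finset.mem_coe.2 (hmem.2 ⟨hR1, ?_⟩), hR2 hxP⟩
    obtain ⟨h2, h3⟩ := hanti P R hR2 hR3.symm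
    have : above P = insert R (above R) := by
      refine (Finset.insert_subset hR h3).antisymm' fun V hV => ?_
      rw [Finset.mem_insert]
      by_cases hVR : V = R
      · exact Or.inl hVR
      obtain ⟨hV1, hV2, hV3⟩ := Finset.mem_filter.1 hV
      exact Or.inr (Finset.mem_filter.2 ⟨hV1, hD.subset_of_side_le hn (hFD R hR1) (hFD V hV1)
        (hmin V hV) (hR2 hxP) (hV2 hxP), hVR⟩)
    rw [this, Finset.card_insert_of_notMem h2] at hP2
    omega
  · intro k P hP
    obtain ⟨hP1, hP2⟩ := hmem.1 (Finset.mem_coe.1 hP)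
    refine (measure_mono ?_).trans (hF P hP1)
    rintro x ⟨hx, hxP⟩
    obtain ⟨R, hR, hxR⟩ := Set.mem_iUnion₂.1 hx
    obtain ⟨hR1, hR2⟩ := hmem.1 (Finset.mem_coe.1 hR)
    have hne : R ≠ P := by rintro rfl; omega
    refine Set.mem_iUnion₂.2 ⟨R, ?_, hxR⟩
    rcases hcomp P hP1 R hR1 x hxP hxR with h | h
    · have := hlt P R hR1 h hne.symm; omega
    · simp [hR1, h, hne]

theorem sum_indicator_le_sparseSquare_sq (F : Finset (Cube n)) (f : (Fin n → ℝ) → ℝ)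
    (x : Fin n → ℝ) :
    ∑ P ∈ F, P.toSet.indicator (fun _ => avg f P ^ 2) x ≤
      sparseSquare 0 (fun k => (generation F k : Set (Cube n))) f x ^ 2 := by
  classical
  have hsq : ∀ a : ℝ≥0∞, (a ^ (1 / 2 : ℝ)) ^ 2 = a := fun a => by
    rw [← ENNReal.rpow_natCast, ← ENNReal.rpow_mul]; norm_num
  rw [sparseSquare, hsq]
  simp only [Cube.dilate_zero]
  set g : Cube n → ℝ≥0∞ := fun P => P.toSet.indicator (fun _ => avg f P ^ 2) x
  have h1 : ∀ k, ∑' P : (generation F k : Set (Cube n)), g P = ∑ P ∈ generation F k, g P :=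
    fun k => Finset.tsum_subtype' (generation F k) g
  change ∑ P ∈ F, g P ≤ ∑' k, ∑' P : (generation F k : Set (Cube n)), g P
  simp only [h1]
  rw [← Finset.sum_fiberwise_of_maps_to
    (g := fun P => ({R ∈ F | P.toSet ⊆ R.toSet ∧ R ≠ P} : Finset (Cube n)).card)
    (t := Finset.range (F.card + 1))
    fun P _ => Finset.mem_range_succ_iff.2 (Finset.card_filter_le _ _)]
  refine le_trans (le_of_eq (Finset.sum_congr rfl fun k _ => ?_)) (ENNReal.sum_le_tsum _)
  unfold generation
  congr!

theorem measurableSet_levelSet {S : ℕ → Set (Cube n)} {D : Set (Cube n)}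
    (hD : IsDyadicGrid D) (hSD : ∀ k, S k ⊆ D) (k : ℕ) : MeasurableSet (levelSet S k) :=
  MeasurableSet.biUnion (hD.countable.mono (hSD k)) fun Q _ => Q.measurableSet

theorem IsSparse.levelSet_subset {S : ℕ → Set (Cube n)} (hS : IsSparse S) {k l : ℕ} (h : k ≤ l) :
    levelSet S l ⊆ levelSet S k :=
  antitone_nat_of_succ_le (f := levelSet S) hS.antitone h

theorem IsSparse.generation_unique {S : ℕ → Set (Cube n)} (hS : IsSparse S) {k l : ℕ} {Q : Cube n}
    (hk : Q ∈ S k) (hl : Q ∈ S l) : k = l := by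
  by_contra hne
  wlog h : k < l generalizing k l
  · exact this hl hk (Ne.symm hne) (by omega)
  have h1 := hS.half k Q hk
  rw [Set.inter_eq_right.2 ((Set.subset_biUnion_of_mem (u := Cube.toSet) hl).trans
    (hS.levelSet_subset h))] at h1
  exact absurd h1 (not_le.2 (ENNReal.half_lt_self Q.volume_pos.ne' Q.volume_ne_top))

/-- The Carleson packing condition of a sparse family: the sets `Q \ Ω_{k+1}`, `Q ∈ S k`, are
disjoint and fill at least half of `Q`. -/
theorem IsSparse.sum_volume_le {S : ℕ → Set (Cube n)} (hS : IsSparse S) {D : Set (Cube n)}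
    (hD : IsDyadicGrid D) (hSD : ∀ k, S k ⊆ D) (s : Finset (Σ k, S k)) (R : Set (Fin n → ℝ))
    (hR : ∀ i ∈ s, (i.2 : Cube n).toSet ⊆ R) :
    ∑ i ∈ s, volume (i.2 : Cube n).toSet ≤ 2 * volume R := by
  set E : (Σ k, S k) → Set (Fin n → ℝ) := fun i => (i.2 : Cube n).toSet \ levelSet S (i.1 + 1)
    with hE
  have hhalf : ∀ i, volume (i.2 : Cube n).toSet ≤ 2 * volume (E i) := by
    intro i
    have h1 := hS.half i.1 i.2 i.2.2
    rw [Set.inter_comm] at h1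
    have h2 := measure_inter_add_sdiff (μ := volume) (i.2 : Cube n).toSet
      (measurableSet_levelSet hD hSD (i.1 + 1))
    have h3 : volume (i.2 : Cube n).toSet / 2 ≤ volume (E i) := by
      have h4 : volume (i.2 : Cube n).toSet / 2 + volume (i.2 : Cube n).toSet / 2 ≤
          volume (i.2 : Cube n).toSet / 2 + volume (E i) := by
        rw [ENNReal.add_halves]
        exact h2.symm.le.trans (add_le_add h1 le_rfl)
      exact (ENNReal.add_le_add_iff_left
        (ENNReal.div_ne_top (i.2 : Cube n).volume_ne_top (by simp))).1 h4
    rw [mul_comm]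
    exact (ENNReal.div_le_iff (by simp) (by simp)).1 h3
  have hdisj : (s : Set (Σ k, S k)).PairwiseDisjoint E := by
    rintro ⟨k, Q⟩ - ⟨l, P⟩ - hne
    have key : ∀ {k l : ℕ} {Q : S k} {P : S l}, k < l → Disjoint (E ⟨k, Q⟩) (E ⟨l, P⟩) := by
      intro k l Q P hkl
      refine Set.disjoint_left.2 fun x hx hy => hx.2 (hS.levelSet_subset hkl ?_)
      exact Set.mem_biUnion P.2 hy.1
    rcases lt_trichotomy k l with h | rfl | h
    · exact key h
    · have hQP : (Q : Cube n) ≠ P := fun h => hne (by rw [Subtype.ext h])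
      exact (hS.disjoint k Q.2 P.2 hQP).mono Set.sdiff_subset Set.sdiff_subset
    · exact (key h).symm
  calc ∑ i ∈ s, volume (i.2 : Cube n).toSet ≤ ∑ i ∈ s, 2 * volume (E i) :=
        Finset.sum_le_sum fun i _ => hhalf i
    _ = 2 * volume (⋃ i ∈ s, E i) := by
        rw [← Finset.mul_sum, measure_biUnion_finset hdisj fun i _ =>
          (i.2 : Cube n).measurableSet.diff (measurableSet_levelSet hD hSD _)]
    _ ≤ 2 * volume R := by
        gcongr
        exact Set.iUnion₂_subset fun i hi => Set.sdiff_subset.trans (hR i hi)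

/-! ### Cubes with ancestors a fixed number of levels above -/

/-- The cube concentric with `Q` of three times its sidelength. -/
def Cube.triple (Q : Cube n) : Cube n where
  corner := fun i => Q.corner i - Q.side
  side := 3 * Q.side
  side_pos := mul_pos three_pos Q.side_pos

theorem Cube.volume_triple (Q : Cube n) : volume Q.triple.toSet = 3 ^ n * volume Q.toSet := by
  rw [Q.triple.volume_toSet, Q.volume_toSet, ← mul_pow, Cube.triple,
    ENNReal.ofReal_mul (by norm_num)]
  norm_num

theorem Cube.subset_triple {R Q : Cube n} (hs : R.side = Q.side)
    (h : (R.toSet ∩ Q.toSet).Nonempty) : R.toSet ⊆ Q.triple.toSet := by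
  obtain ⟨x, hxR, hxQ⟩ := h
  rw [Cube.subset_iff]
  intro i
  have h1 := hxR i
  have h2 := hxQ i
  simp only [Cube.triple]
  constructor <;> linarith

/-- Sparse domination of a sum over cubes `Q i` of the means over cubes `P i ⊇ Q i` of a grid that
lie `M` levels higher, with a bound independent of `M`. That the levels of the cubes `P i` agree
modulo `M` ensures that a cube `P i` is not larger than the cubes `Q j` with `P j` strictly
containing `P i`. The `Q i` need not belong to the grid of the `P i`; they are replaced by the
cubes of that grid that have the same sidelength and meet them. -/
theorem exists_sparse_domination_of_ancestors (hn : 1 ≤ n) {ι : Type*} {D : Set (Cube n)}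
    (hD : IsDyadicGrid D) (f : (Fin n → ℝ) → ℝ) (s : Finset ι) (Q P : ι → Cube n) (M : ℕ) (r : ℤ)
    (hPD : ∀ i ∈ s, P i ∈ D) (hQP : ∀ i ∈ s, (Q i).toSet ⊆ (P i).toSet)
    (hside : ∀ i ∈ s, (P i).side = 2 ^ M * (Q i).side)
    (hlevel : ∀ i ∈ s, ∃ z : ℤ, (P i).side = (2 : ℝ) ^ (M * z + r))
    (hdisj : ∀ i ∈ s, ∀ j ∈ s, i ≠ j → (Q i).side = (Q j).side →
      Disjoint (Q i).toSet (Q j).toSet)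
    (hpack : ∀ (t : Finset ι) (R : Set (Fin n → ℝ)), t ⊆ s → (∀ i ∈ t, (Q i).toSet ⊆ R) →
      ∑ i ∈ t, volume (Q i).toSet ≤ 2 * volume R) :
    ∃ F : Finset (Cube n), (∀ R ∈ F, R ∈ D) ∧ HasSparseChildren F ∧
      ∀ x, ∑ i ∈ s, (Q i).toSet.indicator (fun _ => avg f (P i) ^ 2) x ≤
        16 * (4 * (2 * 3 ^ n) + 1) * ∑ R ∈ F, R.toSet.indicator (fun _ => avg f R ^ 2) x := by
  classical
  set T := s.image P with hT
  set W : Cube n → Set (Cube n) := fun V => {R ∈ D | R.side = V.side / 2 ^ M ∧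
    ∃ i ∈ s, P i = V ∧ (R.toSet ∩ (Q i).toSet).Nonempty} with hW
  set N : Cube n → Set (Fin n → ℝ) := fun V => ⋃ R ∈ W V, R.toSet with hN
  have hTD : ∀ V ∈ T, V ∈ D := fun V hV => by
    obtain ⟨i, hi, rfl⟩ := Finset.mem_image.1 hV
    exact hPD i hi
  have hpow : (1 : ℝ) ≤ 2 ^ M := one_le_pow₀ (by norm_num)
  have hWsub : ∀ V ∈ T, ∀ R ∈ W V, R.toSet ⊆ V.toSet := by
    rintro V hV R ⟨hR, hRs, i, hi, rfl, x, hxR, hxQ⟩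
    refine hD.subset_of_side_le hn hR (hTD _ hV) ?_ hxR (hQP i hi hxQ)
    rw [hRs]
    exact div_le_self (P i).side_pos.le hpow
  have hQN : ∀ i ∈ s, (Q i).toSet ⊆ N (P i) := by
    intro i hi x hx
    obtain ⟨k, hk⟩ := hD.side_eq _ (hPD i hi)
    obtain ⟨R, ⟨hR, hRs, hxR⟩, -⟩ := hD.partition (k - M) x
    refine Set.mem_biUnion (x := R) ⟨hR, ?_, i, hi, rfl, x, hxR, hx⟩ hxR
    rw [hRs, hk, zpow_sub₀ (by norm_num), zpow_natCast]
  have hNvol : ∀ V ∈ T, volume (N V) ≤ 3 ^ n * ∑ i ∈ s with P i = V, volume (Q i).toSet := by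
    intro V hV
    have hsub : N V ⊆ ⋃ i ∈ ({i ∈ s | P i = V} : Finset ι), (Q i).triple.toSet := by
      refine Set.iUnion₂_subset ?_
      rintro R ⟨hR, hRs, i, hi, rfl, hRQ⟩
      have hRs' : R.side = (Q i).side := by
        rw [hRs, hside i hi, mul_div_cancel_left₀ _ (by positivity)]
      exact (Cube.subset_triple hRs' hRQ).trans
        (Set.subset_biUnion_of_mem (u := fun i => (Q i).triple.toSet)
          (s := (({j ∈ s | P j = P i} : Finset ι) : Set ι)) (by simp [hi]))
    calc volume (N V) ≤ ∑ i ∈ s with P i = V, volume (Q i).triple.toSet :=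
          (measure_mono hsub).trans (measure_biUnion_finset_le _ _)
      _ = _ := by simp only [Cube.volume_triple, Finset.mul_sum]
  have hNm : ∀ V, MeasurableSet (N V) := by
    intro V
    have hc : (W V).Countable := by
      refine (hD.countable_side (V.side / 2 ^ M)).mono ?_
      rintro R ⟨hR, hRs, -⟩
      exact ⟨hR, hRs⟩
    exact MeasurableSet.biUnion hc fun R _ => R.measurableSet
  obtain ⟨F, hFT, hF, hsum⟩ := exists_sparse_domination hn hD f N (K := 2 * 3 ^ n)
    (by simp) (by simp [ENNReal.mul_eq_top]) T hTD
    (fun V _ => hNm V)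
    (fun V hV => Set.iUnion₂_subset (hWsub V hV)) (by
      intro P₀ _
      calc ∑ V ∈ T with V.toSet ⊆ P₀.toSet, volume (N V)
          ≤ ∑ V ∈ T with V.toSet ⊆ P₀.toSet, 3 ^ n * ∑ i ∈ s with P i = V, volume (Q i).toSet :=
            Finset.sum_le_sum fun V hV => hNvol V (Finset.mem_filter.1 hV).1
        _ = 3 ^ n * ∑ V ∈ T with V.toSet ⊆ P₀.toSet,
              ∑ i ∈ {i ∈ s | (P i).toSet ⊆ P₀.toSet} with P i = V, volume (Q i).toSet := by
            rw [← Finset.mul_sum]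
            congr 1
            refine Finset.sum_congr rfl fun V hV => Finset.sum_congr ?_ fun _ _ => rfl
            ext i
            simp only [Finset.mem_filter]
            constructor
            · rintro ⟨h1, rfl⟩
              exact ⟨⟨h1, (Finset.mem_filter.1 hV).2⟩, rfl⟩
            · rintro ⟨⟨h1, -⟩, h2⟩
              exact ⟨h1, h2⟩
        _ = 3 ^ n * ∑ i ∈ s with (P i).toSet ⊆ P₀.toSet, volume (Q i).toSet := by
            rw [Finset.sum_fiberwise_of_maps_to (g := P)]
            intro i hi
            obtain ⟨h1, h2⟩ := Finset.mem_filter.1 hi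
            exact Finset.mem_filter.2 ⟨Finset.mem_image_of_mem P h1, h2⟩
        _ ≤ 3 ^ n * (2 * volume P₀.toSet) := by
            gcongr
            refine hpack _ _ (Finset.filter_subset _ _) fun i hi => ?_
            obtain ⟨h1, h2⟩ := Finset.mem_filter.1 hi
            exact (hQP i h1).trans h2
        _ = _ := by ring)
    (by
      intro V hV V' hV' hVV' hne x hx y hy hxN
      obtain ⟨R, hR, hxR⟩ := Set.mem_iUnion₂.1 hxN
      refine Set.mem_biUnion hR (hD.subset_of_side_le hn (hTD V hV) hR.1 ?_ hx hxR hy)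
      rw [hR.2.1, le_div_iff₀ (by positivity)]
      -- two different levels of the same residue class differ by at least `M`
      obtain ⟨i, hi, rfl⟩ := Finset.mem_image.1 hV
      obtain ⟨j, hj, rfl⟩ := Finset.mem_image.1 hV'
      have hlt : (P i).side < (P j).side := lt_of_not_ge fun h =>
        hne (Cube.eq_of_subset_of_side_le hVV' h hn)
      obtain ⟨z, hz⟩ := hlevel i hi
      obtain ⟨z', hz'⟩ := hlevel j hj
      rw [hz, hz'] at hlt ⊢
      rw [zpow_lt_zpow_iff_right₀ (by norm_num)] at hlt
      rw [← zpow_natCast, ← zpow_add₀ (by norm_num), zpow_le_zpow_iff_right₀ (by norm_num)]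
      have h1 : z < z' := by
        by_contra! h
        have := mul_le_mul_of_nonneg_left h (Int.natCast_nonneg M)
        linarith
      have h2 : (M : ℤ) * (z + 1) ≤ M * z' := mul_le_mul_of_nonneg_left h1 (Int.natCast_nonneg M)
      linarith)
  refine ⟨F, fun R hR => hTD R (hFT hR), hF, fun x => le_trans ?_ (hsum x)⟩
  rw [← Finset.sum_fiberwise_of_maps_to (g := P) (t := T)
    fun i hi => Finset.mem_image_of_mem P hi]
  refine Finset.sum_le_sum fun V hV => ?_
  by_cases hx : ∃ i ∈ s, P i = V ∧ x ∈ (Q i).toSet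
  · obtain ⟨i, hi, rfl, hxi⟩ := hx
    rw [Finset.sum_eq_single_of_mem i (by simp [hi])]
    · exact Set.indicator_le_indicator_apply_of_subset (hQN i hi) (by simp)
    · intro j hj hji
      obtain ⟨hj1, hj2⟩ := Finset.mem_filter.1 hj
      refine Set.indicator_of_notMem (fun hxj => ?_) _
      have hs : (Q j).side = (Q i).side := by
        have h1 := hside j hj1
        rw [hj2, hside i hi] at h1
        exact (mul_left_cancel₀ (by positivity) h1).symm
      exact Set.disjoint_left.1 (hdisj j hj1 i hi hji hs) hxj hxi
  · refine (Finset.sum_eq_zero fun i hi => ?_).trans_le zero_le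
    obtain ⟨h1, h2⟩ := Finset.mem_filter.1 hi
    exact Set.indicator_of_notMem (fun h => hx ⟨i, h1, h2, h⟩) _

/-! ### Function norms -/

namespace BanachFunctionNorm

variable {μ : Measure (Fin n → ℝ)}

theorem norm_zero (X : BanachFunctionNorm μ) : X.norm (fun _ => 0) = 0 :=
  (X.eq_zero_iff _ measurable_const).2 (Filter.EventuallyEq.refl _ _)

theorem norm_sum_le (X : BanachFunctionNorm μ) {ι : Type*} (s : Finset ι)
    (g : ι → (Fin n → ℝ) → ℝ≥0∞) (hg : ∀ i ∈ s, Measurable (g i)) :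
    X.norm (fun x => ∑ i ∈ s, g i x) ≤ ∑ i ∈ s, X.norm (g i) := by
  classical
  induction s using Finset.induction_on with
  | empty => simp [X.norm_zero]
  | insert a s ha ih =>
    simp only [Finset.sum_insert ha]
    have hs : ∀ i ∈ s, Measurable (g i) := fun i hi => hg i (Finset.mem_insert_of_mem hi)
    exact (X.triangle _ _ (hg a (Finset.mem_insert_self a s))
      (Finset.measurable_fun_sum s hs)).trans (add_le_add le_rfl (ih hs))

theorem norm_tsum_le (X : BanachFunctionNorm μ) {ι : Type*} [Countable ι]
    (g : ι → (Fin n → ℝ) → ℝ≥0∞) (hg : ∀ i, Measurable (g i)) (B : ℝ≥0∞)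
    (hB : ∀ s : Finset ι, X.norm (fun x => ∑ i ∈ s, g i x) ≤ B) :
    X.norm (fun x => ∑' i, g i x) ≤ B := by
  classical
  rcases isEmpty_or_nonempty ι with hι | hι
  · simpa using hB ∅
  obtain ⟨e, he⟩ := exists_surjective_nat ι
  set s : ℕ → Finset ι := fun k => (Finset.range k).image e
  have hs : Monotone s := fun k l h => Finset.image_subset_image (Finset.range_mono h)
  have hcover : ∀ t : Finset ι, ∃ k, t ⊆ s k := by
    intro t
    induction t using Finset.induction_on with
    | empty => exact ⟨0, by simp⟩
    | insert a t _ ih =>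
      obtain ⟨k, hk⟩ := ih
      obtain ⟨l, rfl⟩ := he a
      refine ⟨max k (l + 1), Finset.insert_subset ?_ (hk.trans (hs (le_max_left _ _)))⟩
      exact Finset.mem_image_of_mem e (Finset.mem_range.2 (by omega))
  rw [X.fatou (fun k x => ∑ i ∈ s k, g i x) _
    (fun k => Finset.measurable_fun_sum _ fun i _ => hg i) (Measurable.tsum hg)
    (Filter.Eventually.of_forall fun x k l h => Finset.sum_le_sum_of_subset (hs h))
    (Filter.Eventually.of_forall fun x => (ENNReal.tsum_eq_iSup_sum' s hcover).symm)]
  exact iSup_le fun k => hB (s k)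

end BanachFunctionNorm

theorem BanachFunctionNorm.normTwo_sq {μ : Measure (Fin n → ℝ)} (X : BanachFunctionNorm μ)
    (h : (Fin n → ℝ) → ℝ≥0∞) : X.normTwo h ^ 2 = X.norm fun x => h x ^ 2 := by
  rw [normTwo, ← ENNReal.rpow_natCast, ← ENNReal.rpow_mul]
  norm_num

theorem measurable_sparseSquare (m : ℕ) {S : ℕ → Set (Cube n)} (hS : ∀ k, (S k).Countable)
    (f : (Fin n → ℝ) → ℝ) : Measurable (sparseSquare m S f) := by
  have hS' : ∀ k, Countable (S k) := fun k => (hS k).to_subtype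
  exact (Measurable.tsum fun k => Measurable.tsum fun Q : S k =>
    measurable_const.indicator (Q : Cube n).measurableSet).pow_const _

/-! ### Comparison of the square functions -/

/-- A cube of a grid whose sidelength lies between `2^m ℓ_Q` and `6 * 2^m ℓ_Q`, with `ℓ_Q` a power
of two, has one of three possible sidelengths. -/
theorem exists_side_eq_two_pow_mul {D : Set (Cube n)} (hD : IsDyadicGrid D) (m : ℕ) {Q P : Cube n}
    (hQ : Q ∈ standardGrid n) (hP : P ∈ D) (h : 2 ^ m * Q.side ≤ P.side)
    (h6 : P.side ≤ 6 * (2 ^ m * Q.side)) :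
    ∃ t : Fin 3, P.side = 2 ^ (m + t : ℕ) * Q.side := by
  obtain ⟨k, hk⟩ := hD.side_eq P hP
  obtain ⟨l, -, hl, -⟩ := hQ
  have h2 : (2 : ℝ) ^ m * 2 ^ (-l) = 2 ^ (m - l : ℤ) := by
    rw [sub_eq_add_neg, zpow_add₀ (by norm_num), zpow_natCast]
  have h8 : (2 : ℝ) ^ (m - l + 3 : ℤ) = 8 * 2 ^ (m - l : ℤ) := by
    rw [zpow_add₀ (by norm_num)]; norm_num [mul_comm]
  have hpos : (0 : ℝ) < 2 ^ (m - l : ℤ) := by positivity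
  rw [hk, hl, h2] at h h6
  rw [zpow_le_zpow_iff_right₀ (by norm_num)] at h
  have hlt : (2 : ℝ) ^ k < 2 ^ (m - l + 3 : ℤ) := by rw [h8]; linarith
  rw [zpow_lt_zpow_iff_right₀ (by norm_num)] at hlt
  refine ⟨⟨(k - (m - l)).toNat, by omega⟩, ?_⟩
  rw [hk, hl, ← zpow_natCast, ← zpow_add₀ (by norm_num)]
  congr 1
  push_cast
  omega

/-- The sum over a class of cubes with ancestors `M` levels above, in norm. -/
theorem norm_sum_avg_ancestors_le (hn : 1 ≤ n) {ι : Type*} {D : Set (Cube n)}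
    (hD : IsDyadicGrid D) {μ : Measure (Fin n → ℝ)} (X : BanachFunctionNorm μ)
    (f : (Fin n → ℝ) → ℝ) (s : Finset ι) (Q P : ι → Cube n) (M : ℕ) (r : ℤ)
    (hPD : ∀ i ∈ s, P i ∈ D) (hQP : ∀ i ∈ s, (Q i).toSet ⊆ (P i).toSet)
    (hside : ∀ i ∈ s, (P i).side = 2 ^ M * (Q i).side)
    (hlevel : ∀ i ∈ s, ∃ z : ℤ, (P i).side = (2 : ℝ) ^ (M * z + r))
    (hdisj : ∀ i ∈ s, ∀ j ∈ s, i ≠ j → (Q i).side = (Q j).side →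
      Disjoint (Q i).toSet (Q j).toSet)
    (hpack : ∀ (t : Finset ι) (R : Set (Fin n → ℝ)), t ⊆ s → (∀ i ∈ t, (Q i).toSet ⊆ R) →
      ∑ i ∈ t, volume (Q i).toSet ≤ 2 * volume R) :
    X.norm (fun x => ∑ i ∈ s, (Q i).toSet.indicator (fun _ => avg f (P i) ^ 2) x) ≤
      (16 * (4 * (2 * 3 ^ n) + 1) : ℝ≥0) * supSparse X 0 D f ^ 2 := by
  obtain ⟨F, hFD, hF, hsum⟩ := exists_sparse_domination_of_ancestors hn hD f s Q P M r hPD hQP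
    hside hlevel hdisj hpack
  set S : ℕ → Set (Cube n) := fun k => (generation F k : Set (Cube n)) with hS
  have hSm : Measurable fun x => sparseSquare 0 S f x ^ 2 :=
    (measurable_sparseSquare 0 (fun k => (generation F k).countable_toSet) f).pow_const 2
  have hSD : ∀ k, S k ⊆ D := fun k R hR => hFD R (Finset.filter_subset _ _ (Finset.mem_coe.1 hR))
  have hle : X.normTwo (sparseSquare 0 S f) ≤ supSparse X 0 D f :=
    le_iSup_of_le S (le_iSup_of_le (isSparse_generation hn hD hFD hF) (le_iSup_of_le hSD le_rfl))
  calc _ ≤ X.norm fun x => ((16 * (4 * (2 * 3 ^ n) + 1) : ℝ≥0) : ℝ≥0∞) *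
          sparseSquare 0 S f x ^ 2 := by
        refine X.mono _ _ (Finset.measurable_fun_sum s fun i _ =>
          measurable_const.indicator (Q i).measurableSet) (hSm.const_mul _)
          (Filter.Eventually.of_forall fun x => (hsum x).trans ?_)
        push_cast
        gcongr
        exact sum_indicator_le_sparseSquare_sq F f x
    _ = (16 * (4 * (2 * 3 ^ n) + 1) : ℝ≥0) * X.normTwo (sparseSquare 0 S f) ^ 2 := by
        rw [X.smul _ _ hSm, X.normTwo_sq]
    _ ≤ _ := by gcongr

/-- The square of the constant in the comparison of the square functions: `36 ^ n` for passing
from `2^m Q` to a cube of a grid, `2 ^ n * 9 * m` as a bound for the number of classes of cubes, and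
the constant of the sparse domination for each class (the factor `m` is kept separate). -/
noncomputable def comparisonConst (n : ℕ) : ℝ≥0 :=
  36 ^ n * (2 ^ n * 9) * (16 * (4 * (2 * 3 ^ n) + 1))

/-- The comparison for finitely many cubes of a sparse family, sorted into the classes on which
`norm_sum_avg_ancestors_le` applies. -/
theorem norm_sum_avg_dilate_le (hn : 1 ≤ n) {D : Fin (2 ^ n) → Set (Cube n)}
    (hD : IsCoveringSystem D) {μ : Measure (Fin n → ℝ)} (X : BanachFunctionNorm μ)
    (f : (Fin n → ℝ) → ℝ) {m : ℕ} (hm : 1 ≤ m) {S : ℕ → Set (Cube n)} (hS : IsSparse S)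
    (hSD : ∀ k, S k ⊆ standardGrid n) (s : Finset (Σ k, S k)) :
    X.norm (fun x => ∑ i ∈ s,
      (i.2 : Cube n).toSet.indicator (fun _ => avg f ((i.2 : Cube n).dilate m) ^ 2) x) ≤
      comparisonConst n * m * (⨆ i, supSparse X 0 (D i) f) ^ 2 := by
  classical
  set B := ⨆ i, supSparse X 0 (D i) f
  set C : ℝ≥0 := 16 * (4 * (2 * 3 ^ n) + 1) with hC
  have hstd : IsDyadicGrid (standardGrid n) :=
    standardGrid_eq_shiftedGrid (n := n) ▸ isDyadicGrid_shiftedGrid hn 0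
  set Q : (Σ k, S k) → Cube n := fun i => i.2
  have hQ : ∀ i, Q i ∈ standardGrid n := fun i => hSD i.1 i.2.2
  choose c P hP hsub h6 using fun i => hD.covers ((Q i).dilate m)
  have hlow : ∀ i, 2 ^ m * (Q i).side ≤ (P i).side := fun i => Cube.side_le_of_subset hn (hsub i)
  choose t ht using fun i => exists_side_eq_two_pow_mul (hD.grid (c i)) m (hQ i) (hP i)
    (hlow i) (h6 i)
  choose k hk using fun i => (hD.grid (c i)).side_eq (P i) (hP i)
  have hQinj : ∀ i j, Q i = Q j → i = j := by
    rintro ⟨k, Q, hQ⟩ ⟨l, R, hR⟩ h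
    obtain rfl : Q = R := h
    obtain rfl := hS.generation_unique hQ hR
    rfl
  -- the level of `P i` modulo the number of levels between `Q i` and `P i`
  have hmod : ∀ i, 0 ≤ k i % (m + t i : ℕ) ∧ k i % (m + t i : ℕ) < (m + t i : ℕ) := fun i =>
    ⟨Int.emod_nonneg _ (by omega), Int.emod_lt_of_pos _ (by omega)⟩
  set ρ : (Σ k, S k) → Fin (m + 2) := fun i => ⟨(k i % (m + t i : ℕ)).toNat, by
    have h1 := hmod i
    have h2 := (t i).2
    omega⟩ with hρ
  set σ : (Σ k, S k) → Fin (2 ^ n) × Fin 3 × Fin (m + 2) := fun i => (c i, t i, ρ i) with hσ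
  have hclass : ∀ a : Fin (2 ^ n) × Fin 3 × Fin (m + 2),
      X.norm (fun x => ∑ i ∈ s with σ i = a, (Q i).toSet.indicator (fun _ => avg f (P i) ^ 2) x) ≤
        C * B ^ 2 := by
    rintro ⟨a, u, v⟩
    have hmem : ∀ i ∈ ({i ∈ s | σ i = (a, u, v)} : Finset _), c i = a ∧ t i = u ∧ ρ i = v := by
      intro i hi
      simpa [hσ] using (Finset.mem_filter.1 hi).2
    refine (norm_sum_avg_ancestors_le hn (hD.grid a) X f _ Q P (m + u) v ?_ ?_ ?_ ?_ ?_ ?_).trans ?_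
    · intro i hi
      exact (hmem i hi).1 ▸ hP i
    · intro i _
      exact (Cube.subset_dilate m (Q i)).trans (hsub i)
    · intro i hi
      rw [ht i, (hmem i hi).2.1]
    · intro i hi
      obtain ⟨-, rfl, rfl⟩ := hmem i hi
      refine ⟨k i / (m + t i : ℕ), ?_⟩
      rw [hk i]
      congr 1
      have h1 := Int.mul_ediv_add_emod (k i) (m + t i : ℕ)
      have h2 : ((ρ i : ℕ) : ℤ) = k i % (m + t i : ℕ) := Int.toNat_of_nonneg (hmod i).1
      rw [h2, h1]
    · intro i _ j _ hij hs
      refine Set.disjoint_left.2 fun x hxi hxj => hij (hQinj i j ?_)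
      exact hstd.eq_of_side_eq (hQ i) (hQ j) hs hxi hxj
    · intro t' R _ hR
      exact hS.sum_volume_le hstd hSD t' R hR
    · gcongr
      exact le_iSup (fun i => supSparse X 0 (D i) f) a
  have hmeas : ∀ i, Measurable fun x => (Q i).toSet.indicator (fun _ => avg f (P i) ^ 2) x :=
    fun i => measurable_const.indicator (Q i).measurableSet
  calc _ ≤ X.norm fun x => ((36 ^ n : ℝ≥0) : ℝ≥0∞) *
          ∑ i ∈ s, (Q i).toSet.indicator (fun _ => avg f (P i) ^ 2) x := by
        refine X.mono _ _ (Finset.measurable_fun_sum s fun i _ =>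
          measurable_const.indicator (Q i).measurableSet)
          ((Finset.measurable_fun_sum s fun i _ => hmeas i).const_mul _)
          (Filter.Eventually.of_forall fun x => ?_)
        simp only [Finset.mul_sum]
        refine Finset.sum_le_sum fun i _ => ?_
        by_cases hx : x ∈ (Q i).toSet
        · rw [Set.indicator_of_mem hx, Set.indicator_of_mem hx]
          calc avg f ((Q i).dilate m) ^ 2 ≤ (ENNReal.ofReal 6 ^ n * avg f (P i)) ^ 2 := by
                gcongr
                exact avg_le_mul_avg f (hsub i) (by norm_num) (h6 i)
            _ = _ := by
                rw [mul_pow, ← pow_mul, mul_comm n 2, pow_mul]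
                norm_num
        · rw [Set.indicator_of_notMem hx]
          exact zero_le
    _ = (36 ^ n : ℝ≥0) * X.norm fun x => ∑ a, ∑ i ∈ s with σ i = a,
          (Q i).toSet.indicator (fun _ => avg f (P i) ^ 2) x := by
        rw [X.smul _ _ (Finset.measurable_fun_sum s fun i _ => hmeas i)]
        simp only [Finset.sum_fiberwise]
    _ ≤ (36 ^ n : ℝ≥0) * ∑ _a : Fin (2 ^ n) × Fin 3 × Fin (m + 2), C * B ^ 2 := by
        gcongr
        exact (X.norm_sum_le _ _ fun a _ => Finset.measurable_fun_sum _ fun i _ => hmeas i).trans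
          (Finset.sum_le_sum fun a _ => hclass a)
    _ = ((36 ^ n * (2 ^ n * (3 * (m + 2 : ℕ))) * C : ℝ≥0) : ℝ≥0∞) * B ^ 2 := by
        simp only [Finset.sum_const, Finset.card_univ, Fintype.card_prod, Fintype.card_fin,
          nsmul_eq_mul]
        push_cast
        ring
    _ ≤ ((comparisonConst n * m : ℝ≥0) : ℝ≥0∞) * B ^ 2 := by
        have hm' : (m + 2 : ℕ) ≤ 3 * (m : ℝ≥0) := by exact_mod_cast (by omega : m + 2 ≤ 3 * m)
        have h1 : 36 ^ n * (2 ^ n * (3 * (m + 2 : ℕ))) * C ≤ comparisonConst n * m :=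
          calc 36 ^ n * (2 ^ n * (3 * (m + 2 : ℕ))) * C
              ≤ 36 ^ n * (2 ^ n * (3 * (3 * (m : ℝ≥0)))) * C := by gcongr
            _ = _ := by rw [comparisonConst, hC]; ring
        exact mul_le_mul_left (ENNReal.coe_le_coe.2 h1) _
    _ = _ := by push_cast; rfl

theorem supSparse_standardGrid_le (hn : 1 ≤ n) {D : Fin (2 ^ n) → Set (Cube n)}
    (hD : IsCoveringSystem D) {μ : Measure (Fin n → ℝ)} (X : BanachFunctionNorm μ)
    (f : (Fin n → ℝ) → ℝ) {m : ℕ} (hm : 1 ≤ m) :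
    supSparse X m (standardGrid n) f ≤ (comparisonConst n ^ (1 / 2 : ℝ) : ℝ≥0) *
      (m : ℝ≥0∞) ^ (1 / 2 : ℝ) * ⨆ i, supSparse X 0 (D i) f := by
  refine iSup_le fun S => iSup_le fun hS => iSup_le fun hSD => ?_
  have hstd : IsDyadicGrid (standardGrid n) :=
    standardGrid_eq_shiftedGrid (n := n) ▸ isDyadicGrid_shiftedGrid hn 0
  have hcount : ∀ k, Countable (S k) := fun k => (hstd.countable.mono (hSD k)).to_subtype
  have h := X.norm_tsum_le (ι := Σ k, S k) (fun i x =>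
    (i.2 : Cube n).toSet.indicator (fun _ => avg f ((i.2 : Cube n).dilate m) ^ 2) x)
    (fun i => measurable_const.indicator (i.2 : Cube n).measurableSet) _
    (norm_sum_avg_dilate_le hn hD X f hm hS hSD)
  have heq : (fun x => sparseSquare m S f x ^ 2) = fun x => ∑' i : Σ k, S k,
      (i.2 : Cube n).toSet.indicator (fun _ => avg f ((i.2 : Cube n).dilate m) ^ 2) x := by
    funext x
    rw [sparseSquare, ← ENNReal.rpow_natCast, ← ENNReal.rpow_mul, ENNReal.tsum_sigma']
    norm_num
  rw [← heq, ← X.normTwo_sq] at h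
  have h2 := ENNReal.rpow_le_rpow h (by norm_num : (0 : ℝ) ≤ 1 / 2)
  have hsq : ∀ a : ℝ≥0∞, (a ^ 2) ^ (1 / 2 : ℝ) = a := fun a => by
    rw [← ENNReal.rpow_natCast, ← ENNReal.rpow_mul]; norm_num
  rwa [ENNReal.mul_rpow_of_nonneg _ _ (by norm_num), ENNReal.mul_rpow_of_nonneg _ _ (by norm_num),
    hsq, hsq, ← ENNReal.coe_rpow_of_nonneg _ (by norm_num)] at h2

end SparseSquare

theorem lemma4p3 (n : ℕ) (hn : 1 ≤ n) :
    (∃ D : Fin (2 ^ n) → Set (SparseSquare.Cube n), SparseSquare.IsCoveringSystem D) ∧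
    ∃ c : ℝ≥0, ∀ D : Fin (2 ^ n) → Set (SparseSquare.Cube n), SparseSquare.IsCoveringSystem D →
      ∀ (μ : Measure (Fin n → ℝ)) [SigmaFinite μ], μ ≪ volume →
      ∀ (X : SparseSquare.BanachFunctionNorm μ) (f : (Fin n → ℝ) → ℝ), AEMeasurable f volume →
      ∀ m : ℕ, 1 ≤ m →
        SparseSquare.supSparse X m (SparseSquare.standardGrid n) f ≤
          c * (m : ℝ≥0∞) ^ (1 / 2 : ℝ) * ⨆ i, SparseSquare.supSparse X 0 (D i) f :=
  ⟨SparseSquare.exists_isCoveringSystem hn,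
    SparseSquare.comparisonConst n ^ (1 / 2 : ℝ),
    fun _ hD _ _ _ X f _ _ hm => SparseSquare.supSparse_standardGrid_le hn hD X f hm⟩
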